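/- For each $n$ let $(S_n,\|\cdot\|_n)$ be a complete separable (real) normed space, and let $X_n$ and $Y_n$ be random elements of $S_n$ (not necessarily defined on the same probability space). For real $r\ge 1$ let $$\mathsf{PL}_n(r)=\Big\{f\colon S_n\to\mathbb{R} \;:\; |f(x)-f(y)|\le \|x-y\|_n\big(1+\|x\|_n^{r-1}+\|y\|_n^{r-1}\big)\ \text{ for all } x,y\in S_n\Big\}.$$ A coupling of $(X_n,Y_n)$ is a probability measure on $S_n\times S_n$ whose marginals are the laws of $X_n$ and $Y_n$. Consider the following statements. (i) There exists a sequence of couplings of $(X_n,Y_n)$ under which $\|X_n-Y_n\|_n\to 0$ in probability as $n\to\infty$. (ii) $\lim_{t\to\infty}\limsup_{n\to\infty}\mathbb{P}(\|X_n\|_n\ge t)=0$, or $\lim_{t\to\infty}\limsup_{n\to\infty}\mathbb{P}(\|Y_n\|_n\ge t)=0$. (iii) There exists a sequence of couplings of $(X_n,Y_n)$ under which, for every real $r\ge 1$ and every sequence of functions $f_n\in\mathsf{PL}_n(r)$, $|f_n(X_n)-f_n(Y_n)|\to 0$ in probability as $n\to\infty$. Then (i) and (ii) together imply (iii), and (iii)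 implies (i). -/

import Mathlib

open MeasureTheory Filter Topology

/-- A coupling of a random element `X` on `(Ω, P)` and a random element `Y` on `(Ω', P')`, both
with values in `S`: a probability measure on `S × S` whose marginals are the laws of `X` and `Y`. -/
structure IsCoupling {S Ω Ω' : Type*} [MeasurableSpace S] [MeasurableSpace Ω]
    [MeasurableSpace Ω'] (P : Measure Ω) (X : Ω → S) (P' : Measure Ω') (Y : Ω' → S)
    (π : Measure (S × S)) : Prop where
  isProbabilityMeasure : IsProbabilityMeasure π
  map_fst : π.map Prod.fst = P.map X
  map_snd : π.map Prod.snd = P'.map Y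

/-- Convergence to zero in probability of real random variables `Z n`, each defined on its own
probability space `(E n, π n)`. -/
def TendstoZeroInProb {E : ℕ → Type*} [∀ n, MeasurableSpace (E n)]
    (π : ∀ n, Measure (E n)) (Z : ∀ n, E n → ℝ) : Prop :=
  ∀ ε : ℝ, 0 < ε → Tendsto (fun n => π n {e | ε ≤ |Z n e|}) atTop (𝓝 0)

/-- The pseudo-Lipschitz functions of order `r` on a normed space (with constant one). -/
def PL (S : Type*) [NormedAddCommGroup S] (r : ℝ) : Set (S → ℝ) :=
  {f | ∀ x y : S, |f x - f y| ≤ ‖x - y‖ * (1 + ‖x‖ ^ (r - 1) + ‖y‖ ^ (r - 1))}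

/-- The tail condition `lim_{t → ∞} limsup_{n → ∞} P(‖X n‖ ≥ t) = 0`. -/
def TightNorms {S Ω : ℕ → Type*} [∀ n, NormedAddCommGroup (S n)] [∀ n, MeasurableSpace (Ω n)]
    (P : ∀ n, Measure (Ω n)) (X : ∀ n, Ω n → S n) : Prop :=
  Tendsto (fun t : ℝ => limsup (fun n => P n {ω | t ≤ ‖X n ω‖}) atTop) atTop (𝓝 0)

/-- There are couplings of `X n` and `Y n` under which `‖X n - Y n‖ → 0` in probability. -/
def CoupledNormConv {S Ω Ω' : ℕ → Type*} [∀ n, NormedAddCommGroup (S n)]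
    [∀ n, MeasurableSpace (S n)] [∀ n, MeasurableSpace (Ω n)] [∀ n, MeasurableSpace (Ω' n)]
    (P : ∀ n, Measure (Ω n)) (X : ∀ n, Ω n → S n)
    (P' : ∀ n, Measure (Ω' n)) (Y : ∀ n, Ω' n → S n) : Prop :=
  ∃ π : ∀ n, Measure (S n × S n), (∀ n, IsCoupling (P n) (X n) (P' n) (Y n) (π n)) ∧
    TendstoZeroInProb π (fun _ p => ‖p.1 - p.2‖)

/-- There are couplings of `X n` and `Y n` under which `|f n (X n) - f n (Y n)| → 0` in
probability, simultaneously for every order `r ≥ 1` and every sequence `f n ∈ PL (S n) r`. -/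
def CoupledPLConv {S Ω Ω' : ℕ → Type*} [∀ n, NormedAddCommGroup (S n)]
    [∀ n, MeasurableSpace (S n)] [∀ n, MeasurableSpace (Ω n)] [∀ n, MeasurableSpace (Ω' n)]
    (P : ∀ n, Measure (Ω n)) (X : ∀ n, Ω n → S n)
    (P' : ∀ n, Measure (Ω' n)) (Y : ∀ n, Ω' n → S n) : Prop :=
  ∃ π : ∀ n, Measure (S n × S n), (∀ n, IsCoupling (P n) (X n) (P' n) (Y n) (π n)) ∧
    ∀ r : ℝ, 1 ≤ r → ∀ f : ∀ n, S n → ℝ, (∀ n, f n ∈ PL (S n) r) →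
      TendstoZeroInProb π (fun n p => |f n p.1 - f n p.2|)

/-! (i) and (ii) give (iii) with the same couplings: off an event of small probability both points
lie in one ball, where a pseudo-Lipschitz function has a fixed Lipschitz bound
(`tendstoZeroInProb_of_mem_PL`).

For the converse, distance functions to sets are admissible test functions, so the law of `X n` of
any set is eventually at most the law of `Y n` of its `ε`-thickening, plus `ε`, uniformly over sets
(`eventually_measure_le_thickening`). Strassen's theorem (`exists_coupling_of_thickening`) turns
this into new couplings, and a diagonal choice lets `ε` tend to zero. Strassen's theorem itself
comes from Hall's marriage theorem on a finite partition, after rounding masses to integers. -/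

/-! ### Finite transport from Hall's theorem -/

theorem exists_nat_transport {ι : Type*} [Fintype ι] [DecidableEq ι] (R : ι → ι → Prop)
    (a b : ι → ℕ) (k : ℕ)
    (h : ∀ A B : Finset ι, (∀ i ∈ A, ∀ j, R i j → j ∈ B) → ∑ i ∈ A, a i ≤ ∑ j ∈ B, b j + k) :
    ∃ w : ι → ι → ℕ, (∀ i j, w i j ≠ 0 → R i j) ∧ (∀ i, ∑ j, w i j ≤ a i) ∧
      (∀ j, ∑ i, w i j ≤ b j) ∧ ∑ i, a i ≤ ∑ i, ∑ j, w i j + k := by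
  classical
  -- Units of supply are matched to related units of demand; `k` dummies, open to everyone, absorb
  -- the defect in Hall's condition.
  let t : (Σ i, Fin (a i)) → Finset ((Σ j, Fin (b j)) ⊕ Fin k) := fun x =>
    (Finset.univ.filter fun y : Σ j, Fin (b j) => R x.1 y.1).disjSum Finset.univ
  have hall : ∀ s : Finset (Σ i, Fin (a i)), s.card ≤ (s.biUnion t).card := by
    intro s
    rcases s.eq_empty_or_nonempty with rfl | ⟨x₀, hx₀⟩
    · simp
    set A := s.image Sigma.fst
    set B := Finset.univ.filter fun j => ∃ i ∈ A, R i j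
    have h1 : s.card ≤ ∑ i ∈ A, a i := by
      have : s ⊆ A.sigma fun _ => Finset.univ := by
        intro x hx
        simp only [Finset.mem_sigma, Finset.mem_univ, and_true]
        exact Finset.mem_image_of_mem _ hx
      simpa using Finset.card_le_card this
    have h2 : (∑ j ∈ B, b j) + k ≤ (s.biUnion t).card := by
      have : (B.sigma fun j => (Finset.univ : Finset (Fin (b j)))).disjSum
          (Finset.univ : Finset (Fin k)) ⊆ s.biUnion t := by
        intro y hy
        rw [Finset.mem_biUnion]
        rcases y with y | y
        · simp only [Finset.inl_mem_disjSum, Finset.mem_sigma, Finset.mem_univ, and_true, B,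
            Finset.mem_filter, true_and, A, Finset.mem_image] at hy
          obtain ⟨_, ⟨x, hx, rfl⟩, hR⟩ := hy
          exact ⟨x, hx, by simpa [t] using hR⟩
        · exact ⟨x₀, hx₀, by simp [t]⟩
      simpa [Finset.card_disjSum] using Finset.card_le_card this
    have h3 := h A B (fun i hi j hR =>
      Finset.mem_filter.2 ⟨Finset.mem_univ _, i, hi, hR⟩)
    omega
  obtain ⟨f, hf, hft⟩ := (Finset.all_card_le_biUnion_card_iff_exists_injective t).1 hall
  let W : ι → ι → Finset (Σ i, Fin (a i)) := fun i j =>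
    Finset.univ.filter fun x => x.1 = i ∧ ∃ y, f x = Sum.inl ⟨j, y⟩
  have hrow : ∀ i, (Set.univ : Set ι).PairwiseDisjoint (W i) := by
    intro i j _ j' _ hjj
    rw [Function.onFun, Finset.disjoint_left]
    intro x hx hx'
    simp only [W, Finset.mem_filter, Finset.mem_univ, true_and] at hx hx'
    obtain ⟨-, y, hy⟩ := hx
    obtain ⟨-, y', hy'⟩ := hx'
    rw [hy] at hy'
    simp only [Sum.inl.injEq, Sigma.mk.injEq] at hy'
    exact hjj hy'.1
  have hcol : ∀ j, (Set.univ : Set ι).PairwiseDisjoint (fun i => W i j) := by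
    intro j i _ i' _ hii
    rw [Function.onFun, Finset.disjoint_left]
    intro x hx hx'
    simp only [W, Finset.mem_filter, Finset.mem_univ, true_and] at hx hx'
    exact hii (hx.1.symm.trans hx'.1)
  refine ⟨fun i j => (W i j).card, ?_, ?_, ?_, ?_⟩
  · intro i j hw
    obtain ⟨x, hx⟩ := Finset.card_ne_zero.1 hw
    simp only [W, Finset.mem_filter, Finset.mem_univ, true_and] at hx
    obtain ⟨rfl, y, hy⟩ := hx
    have := hft x
    rw [hy] at this
    simpa [t] using this
  · intro i
    rw [← Finset.card_biUnion (fun j hj j' hj' hne => hrow i (by simp) (by simp) hne)]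
    calc _ ≤ (({i} : Finset ι).sigma fun i => (Finset.univ : Finset (Fin (a i)))).card := by
          refine Finset.card_le_card fun x hx => ?_
          simp only [W, Finset.mem_biUnion, Finset.mem_filter, Finset.mem_univ, true_and] at hx
          obtain ⟨_, hx, _⟩ := hx
          simp [hx]
      _ = a i := by simp
  · intro j
    rw [← Finset.card_biUnion (fun i hi i' hi' hne => hcol j (by simp) (by simp) hne)]
    calc _ ≤ ((({j} : Finset ι).sigma fun j => (Finset.univ : Finset (Fin (b j)))).map
              (Function.Embedding.inl (β := Fin k))).card := by
          refine Finset.card_le_card_of_injOn f (fun x hx => ?_) hf.injOn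
          simp only [W, Finset.coe_biUnion, Finset.coe_filter, Finset.mem_univ, true_and,
            Set.mem_iUnion, Set.mem_ofPred_eq, Finset.mem_coe] at hx
          obtain ⟨_, _, _, y, hy⟩ := hx
          simp [hy]
      _ = b j := by simp
  · calc ∑ i, a i = (Finset.univ : Finset (Σ i, Fin (a i))).card := by simp
      _ ≤ ((Finset.univ.biUnion fun i => Finset.univ.biUnion (W i)) ∪
            Finset.univ.filter fun x => ∃ z, f x = Sum.inr z).card := by
          refine Finset.card_le_card fun x _ => ?_
          rcases hx : f x with y | z
          · refine Finset.mem_union_left _ ?_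
            simp only [W, Finset.mem_biUnion, Finset.mem_filter, Finset.mem_univ, true_and]
            exact ⟨x.1, y.1, rfl, y.2, hx⟩
          · refine Finset.mem_union_right _ ?_
            simpa using ⟨z, hx⟩
      _ ≤ (∑ i, ∑ j, (W i j).card) + k := by
          refine (Finset.card_union_le _ _).trans (add_le_add ?_ ?_)
          · exact Finset.card_biUnion_le.trans
              (Finset.sum_le_sum fun i _ => Finset.card_biUnion_le)
          · calc _ ≤ ((Finset.univ : Finset (Fin k)).map
                    (Function.Embedding.inr (α := Σ j, Fin (b j)))).card := by
                  refine Finset.card_le_card_of_injOn f (fun x hx => ?_) hf.injOn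
                  simp only [Finset.coe_filter, Finset.mem_univ, true_and,
                    Set.mem_ofPred_eq] at hx
                  obtain ⟨z, hz⟩ := hx
                  simp [hz]
              _ = k := by simp

theorem exists_real_transport {ι : Type*} [Fintype ι] [DecidableEq ι] (R : ι → ι → Prop)
    (a b : ι → ℝ) (ha : ∀ i, 0 ≤ a i) (hb : ∀ i, 0 ≤ b i) (ε δ : ℝ) (hε : 0 ≤ ε) (hδ : 0 < δ)
    (h : ∀ A B : Finset ι, (∀ i ∈ A, ∀ j, R i j → j ∈ B) → ∑ i ∈ A, a i ≤ ∑ j ∈ B, b j + ε) :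
    ∃ w : ι → ι → ℝ, (∀ i j, 0 ≤ w i j) ∧ (∀ i j, w i j ≠ 0 → R i j) ∧ (∀ i, ∑ j, w i j ≤ a i) ∧
      (∀ j, ∑ i, w i j ≤ b j) ∧ ∑ i, a i ≤ ∑ i, ∑ j, w i j + ε + δ := by
  -- In units of `1 / N`, rounding `a` and `b` down costs at most `card ι` each and rounding `N * ε`
  -- up at most one; this `N` keeps the total below `δ`.
  obtain ⟨N, hN⟩ := exists_nat_gt ((2 * Fintype.card ι + 1) / δ)
  have hN0 : (0 : ℝ) < N := lt_of_le_of_lt (by positivity) hN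
  rw [div_lt_iff₀ hδ] at hN
  have hlow : ∀ (c : ι → ℝ) (B : Finset ι),
      N * ∑ j ∈ B, c j ≤ (∑ j ∈ B, ⌊N * c j⌋₊ : ℕ) + Fintype.card ι := by
    intro c B
    have h1 : ∑ j ∈ B, (N * c j) ≤ ∑ j ∈ B, ((⌊N * c j⌋₊ : ℝ) + 1) :=
      Finset.sum_le_sum fun j _ => (Nat.lt_floor_add_one _).le
    rw [Finset.sum_add_distrib, ← Finset.mul_sum, Finset.sum_const, nsmul_eq_mul, mul_one] at h1
    have h2 : (B.card : ℝ) ≤ Fintype.card ι := by exact_mod_cast B.card_le_univ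
    push_cast
    linarith
  have hup : ∀ (c : ι → ℝ) (A : Finset ι), (∀ i, 0 ≤ c i) →
      ((∑ j ∈ A, ⌊N * c j⌋₊ : ℕ) : ℝ) ≤ N * ∑ j ∈ A, c j := by
    intro c A hc
    rw [Finset.mul_sum]
    push_cast
    exact Finset.sum_le_sum fun j _ => Nat.floor_le (mul_nonneg hN0.le (hc j))
  obtain ⟨w, hwR, hwa, hwb, hw⟩ := exists_nat_transport R (fun i => ⌊N * a i⌋₊)
    (fun i => ⌊N * b i⌋₊) (⌈N * ε⌉₊ + Fintype.card ι) (by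
      intro A B hAB
      have h1 := hup a A ha
      have h2 := hlow b B
      have h3 := mul_le_mul_of_nonneg_left (h A B hAB) hN0.le
      have h4 := Nat.le_ceil (N * ε)
      rw [← Nat.cast_le (α := ℝ)]
      push_cast at *
      linarith)
  refine ⟨fun i j => w i j / N, fun i j => by positivity, fun i j hij => hwR i j ?_, fun i => ?_,
    fun j => ?_, ?_⟩
  · rintro h0
    simp [h0] at hij
  · rw [← Finset.sum_div, div_le_iff₀ hN0]
    calc _ ≤ ((⌊N * a i⌋₊ : ℕ) : ℝ) := by exact_mod_cast hwa i
      _ ≤ N * a i := Nat.floor_le (mul_nonneg hN0.le (ha i))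
      _ = _ := mul_comm _ _
  · rw [← Finset.sum_div, div_le_iff₀ hN0]
    calc _ ≤ ((⌊N * b j⌋₊ : ℕ) : ℝ) := by exact_mod_cast hwb j
      _ ≤ N * b j := Nat.floor_le (mul_nonneg hN0.le (hb j))
      _ = _ := mul_comm _ _
  · simp_rw [← Finset.sum_div]
    have h1 := hlow a Finset.univ
    have h2 : ((∑ i, ⌊N * a i⌋₊ : ℕ) : ℝ) ≤
        ((∑ i, ∑ j, w i j + (⌈N * ε⌉₊ + Fintype.card ι) : ℕ) : ℝ) := by exact_mod_cast hw
    have h3 := (Nat.ceil_lt_add_one (mul_nonneg hN0.le hε)).le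
    rw [← mul_le_mul_iff_right₀ hN0, mul_add, mul_add, mul_div_cancel₀ _ hN0.ne']
    push_cast at h1 h2 h3 ⊢
    linarith

/-! ### Building couplings from partial and discrete data -/

theorem inv_mul_smul_self {α : Type*} [MeasurableSpace α] (τ : Measure α) [IsFiniteMeasure τ] :
    ((τ Set.univ)⁻¹ * τ Set.univ) • τ = τ := by
  by_cases h0 : τ Set.univ = 0
  · simp [Measure.measure_univ_eq_zero.1 h0]
  · rw [ENNReal.inv_mul_cancel h0 (measure_ne_top _ _), one_smul]

/-- A measure on the product with marginals dominated by those prescribed extends to a coupling. -/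
theorem exists_coupling_ge {α β : Type*} [MeasurableSpace α] [MeasurableSpace β]
    (μ : Measure α) (ν : Measure β) [IsProbabilityMeasure μ] [IsProbabilityMeasure ν]
    (ρ : Measure (α × β)) [IsFiniteMeasure ρ] (h₁ : ρ.map Prod.fst ≤ μ)
    (h₂ : ρ.map Prod.snd ≤ ν) :
    ∃ π : Measure (α × β), ρ ≤ π ∧ π.map Prod.fst = μ ∧ π.map Prod.snd = ν := by
  set μ' := μ - ρ.map Prod.fst
  set ν' := ν - ρ.map Prod.snd
  have hμ : μ' + ρ.map Prod.fst = μ := Measure.sub_add_cancel_of_le h₁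
  have hν : ν' + ρ.map Prod.snd = ν := Measure.sub_add_cancel_of_le h₂
  have e₁ : μ' Set.univ + ρ Set.univ = 1 := by
    rw [← measure_univ (μ := μ), ← hμ]
    simp [Measure.map_apply measurable_fst]
  have e₂ : ν' Set.univ + ρ Set.univ = 1 := by
    rw [← measure_univ (μ := ν), ← hν]
    simp [Measure.map_apply measurable_snd]
  have e : μ' Set.univ = ν' Set.univ :=
    (ENNReal.add_left_inj (measure_ne_top ρ _)).1 (e₁.trans e₂.symm)
  -- The leftover marginals have equal mass, so their product divided by that mass has them as
  -- marginals; zero leftover mass gives the zero measure.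
  refine ⟨(μ' Set.univ)⁻¹ • μ'.prod ν' + ρ, Measure.le_add_left le_rfl, ?_, ?_⟩
  · rw [Measure.map_add _ _ measurable_fst, Measure.map_smul, Measure.map_fst_prod, smul_smul,
      ← e, inv_mul_smul_self, hμ]
  · rw [Measure.map_add _ _ measurable_snd, Measure.map_smul, Measure.map_snd_prod, smul_smul,
      e, inv_mul_smul_self, hν]

/-- Disjointed `ε`-balls around a dense sequence cover the space, so continuity from above lets
finitely many of them suffice. -/
theorem exists_finite_partition {S : Type*} [PseudoMetricSpace S]
    [TopologicalSpace.SeparableSpace S] [MeasurableSpace S] [BorelSpace S]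
    (μ : Measure S) [IsFiniteMeasure μ] {ε : ℝ} (hε : 0 < ε) :
    ∃ (m : ℕ) (A : Fin m → Set S), (∀ i, MeasurableSet (A i)) ∧
      Pairwise (Function.onFun Disjoint A) ∧ (∀ i, ∀ x ∈ A i, ∀ y ∈ A i, dist x y < 2 * ε) ∧
      μ (⋃ i, A i)ᶜ ≤ ENNReal.ofReal ε := by
  rcases isEmpty_or_nonempty S with hS | hS
  · exact ⟨0, fun _ => ∅, fun i => i.elim0, fun i => i.elim0, fun i => i.elim0, by
      rw [Set.eq_empty_of_isEmpty (_)ᶜ]; simp⟩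
  set D := disjointed fun i => Metric.ball (TopologicalSpace.denseSeq S i) ε
  have hDm : ∀ i, MeasurableSet (D i) :=
    MeasurableSet.disjointed fun i => Metric.isOpen_ball.measurableSet
  have hD : ⋃ i, D i = Set.univ := by
    rw [iUnion_disjointed, Set.eq_univ_iff_forall]
    intro x
    obtain ⟨i, hi⟩ := (TopologicalSpace.denseRange_denseSeq S).exists_dist_lt x hε
    exact Set.mem_iUnion.2 ⟨i, hi⟩
  have hlim : Tendsto (fun m : ℕ => μ (⋃ i : Fin m, D i)ᶜ) atTop
      (𝓝 (μ (⋂ m : ℕ, (⋃ i : Fin m, D i)ᶜ))) := by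
    refine tendsto_measure_iInter_atTop
      (fun m => (MeasurableSet.iUnion fun i : Fin m => hDm i).compl.nullMeasurableSet) ?_
      ⟨0, measure_ne_top _ _⟩
    intro m n hmn
    refine Set.compl_subset_compl.2 (Set.iUnion_subset fun i => ?_)
    exact Set.subset_iUnion (fun i : Fin n => D i) (Fin.castLE hmn i)
  have hzero : ⋂ m : ℕ, (⋃ i : Fin m, D i)ᶜ = ∅ := by
    rw [← Set.compl_iUnion, Set.compl_empty_iff, Set.eq_univ_iff_forall]
    intro x
    obtain ⟨i, hi⟩ := Set.mem_iUnion.1 (hD ▸ Set.mem_univ x : x ∈ ⋃ i, D i)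
    exact Set.mem_iUnion.2 ⟨i + 1, Set.mem_iUnion.2 ⟨Fin.last i, hi⟩⟩
  rw [hzero, measure_empty] at hlim
  obtain ⟨m, hm⟩ := (hlim.eventually_lt_const (ENNReal.ofReal_pos.2 hε)).exists
  refine ⟨m, fun i => D i, fun i => hDm i, ?_, ?_, hm.le⟩
  · intro i j hij
    exact disjoint_disjointed _ (Fin.val_injective.ne hij)
  · intro i x hx y hy
    have hx := disjointed_subset (fun i => Metric.ball (TopologicalSpace.denseSeq S i) ε) _ hx
    have hy := disjointed_subset (fun i => Metric.ball (TopologicalSpace.denseSeq S i) ε) _ hy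
    rw [Metric.mem_ball] at hx hy
    linarith [dist_triangle_right x y (TopologicalSpace.denseSeq S i)]

/-- A transport plan between the cells of a partition spreads out to a measure on the product. -/
theorem exists_subcoupling_of_plan {α ι : Type*} [Fintype ι] [MeasurableSpace α]
    (μ ν : Measure α) [IsProbabilityMeasure μ] [IsProbabilityMeasure ν] (A : ι → Set α)
    (hA : ∀ i, MeasurableSet (A i)) (hdisj : Pairwise (Function.onFun Disjoint A))
    (w : ι → ι → ℝ) (hw : ∀ i j, 0 ≤ w i j) (hrow : ∀ i, ∑ j, w i j ≤ μ.real (A i))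
    (hcol : ∀ j, ∑ i, w i j ≤ ν.real (A j)) :
    ∃ ρ : Measure (α × α), ρ.map Prod.fst ≤ μ ∧ ρ.map Prod.snd ≤ ν ∧
      ρ Set.univ = ENNReal.ofReal (∑ i, ∑ j, w i j) ∧
      ∀ B : Set (α × α), (∀ i j, w i j ≠ 0 → A i ×ˢ A j ⊆ Bᶜ) → ρ B = 0 := by
  set u : ι → ι → ENNReal := fun i j => ENNReal.ofReal (w i j)
  have hrow' : ∀ i, ∑ j, u i j ≤ μ (A i) := fun i => by
    rw [← ENNReal.ofReal_sum_of_nonneg fun j _ => hw i j]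
    exact ENNReal.ofReal_le_of_le_toReal (hrow i)
  have hcol' : ∀ j, ∑ i, u i j ≤ ν (A j) := fun j => by
    rw [← ENNReal.ofReal_sum_of_nonneg fun i _ => hw i j]
    exact ENNReal.ofReal_le_of_le_toReal (hcol j)
  have hμ0 : ∀ i j, μ (A i) = 0 → u i j = 0 := fun i j h => by
    have := (Finset.single_le_sum (f := u i) (fun _ _ => zero_le) (Finset.mem_univ j)).trans
      (hrow' i)
    simpa [h] using this
  have hν0 : ∀ i j, ν (A j) = 0 → u i j = 0 := fun i j h => by
    have := (Finset.single_le_sum (f := fun i => u i j) (fun _ _ => zero_le)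
      (Finset.mem_univ i)).trans (hcol' j)
    simpa [h] using this
  -- Density giving the block `A i ×ˢ A j` mass `u i j`. On null cells the infinite inverse is
  -- harmless, since `u i j = 0` there.
  set c : ι → ι → ENNReal := fun i j => u i j * (μ (A i))⁻¹ * (ν (A j))⁻¹
  have hcν : ∀ i j, c i j * ν (A j) = u i j * (μ (A i))⁻¹ := fun i j => by
    by_cases h : ν (A j) = 0
    · simp [hν0 i j h, h]
    · rw [mul_assoc, ENNReal.inv_mul_cancel h (measure_ne_top _ _), mul_one]
  have hcμ : ∀ i j, c i j * μ (A i) = u i j * (ν (A j))⁻¹ := fun i j => by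
    by_cases h : μ (A i) = 0
    · simp [hμ0 i j h, h]
    · rw [show c i j * μ (A i) = u i j * (ν (A j))⁻¹ * ((μ (A i))⁻¹ * μ (A i)) by
        simp only [c]; ring, ENNReal.inv_mul_cancel h (measure_ne_top _ _), mul_one]
  have hcμν : ∀ i j, c i j * (μ (A i) * ν (A j)) = u i j := fun i j => by
    by_cases h : μ (A i) = 0
    · simp [hμ0 i j h, h]
    · rw [mul_comm (μ _), ← mul_assoc, hcν, mul_assoc,
        ENNReal.inv_mul_cancel h (measure_ne_top _ _), mul_one]
  have hsum : ∀ (τ : Measure α), ∑ i, τ.restrict (A i) ≤ τ := fun τ => by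
    rw [← Measure.sum_fintype, ← Measure.restrict_iUnion hdisj hA]
    exact Measure.restrict_le_self
  have hsmul : ∀ (s : ENNReal) (τ : Measure α), s ≤ 1 → s • τ ≤ τ := fun s τ hs =>
    Measure.le_iff.2 fun B _ => by
      simpa using mul_le_mul_left hs (τ B)
  refine ⟨∑ i, ∑ j, c i j • (μ.restrict (A i)).prod (ν.restrict (A j)), ?_, ?_, ?_, ?_⟩
  · refine le_trans ?_ (hsum μ)
    have : (∑ i, ∑ j, c i j • (μ.restrict (A i)).prod (ν.restrict (A j))).map Prod.fst =
        ∑ i, (∑ j, u i j * (μ (A i))⁻¹) • μ.restrict (A i) := by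
      rw [← Measure.mapₗ_apply_of_measurable measurable_fst]
      simp only [map_sum, map_smul]
      simp only [Measure.mapₗ_apply_of_measurable measurable_fst, Measure.map_fst_prod, smul_smul,
        Measure.restrict_apply_univ, hcν, Finset.sum_smul]
    rw [this]
    refine Finset.sum_le_sum fun i _ => hsmul _ _ ?_
    rw [← Finset.sum_mul, ← div_eq_mul_inv]
    exact ENNReal.div_le_of_le_mul (by simpa using hrow' i)
  · refine le_trans ?_ (hsum ν)
    have : (∑ i, ∑ j, c i j • (μ.restrict (A i)).prod (ν.restrict (A j))).map Prod.snd =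
        ∑ j, (∑ i, u i j * (ν (A j))⁻¹) • ν.restrict (A j) := by
      rw [← Measure.mapₗ_apply_of_measurable measurable_snd]
      simp only [map_sum, map_smul]
      simp only [Measure.mapₗ_apply_of_measurable measurable_snd, Measure.map_snd_prod, smul_smul,
        Measure.restrict_apply_univ, hcμ, Finset.sum_smul]
      exact Finset.sum_comm
    rw [this]
    refine Finset.sum_le_sum fun j _ => hsmul _ _ ?_
    rw [← Finset.sum_mul, ← div_eq_mul_inv]
    exact ENNReal.div_le_of_le_mul (by simpa using hcol' j)
  · rw [ENNReal.ofReal_sum_of_nonneg fun i _ => Finset.sum_nonneg fun j _ => hw i j]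
    simp only [Measure.finsetSum_apply, Measure.smul_apply, smul_eq_mul, ← Set.univ_prod_univ,
      Measure.prod_prod, Measure.restrict_apply_univ, hcμν]
    exact Finset.sum_congr rfl fun i _ => (ENNReal.ofReal_sum_of_nonneg fun j _ => hw i j).symm
  · intro B hB
    simp only [Measure.finsetSum_apply, Measure.smul_apply, smul_eq_mul]
    refine Finset.sum_eq_zero fun i _ => Finset.sum_eq_zero fun j _ => ?_
    by_cases h : w i j = 0
    · simp [c, u, h]
    · rw [Measure.prod_restrict, Measure.restrict_apply₀' ((hA i).prod (hA j)).nullMeasurableSet,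
        Set.disjoint_iff_inter_eq_empty.1
          (Set.subset_compl_iff_disjoint_left.1 (hB i j h)), measure_empty, mul_zero]

/-! ### Strassen's theorem -/

/-- A quantitative form of Strassen's theorem. -/
theorem exists_coupling_of_thickening {S : Type*} [PseudoMetricSpace S]
    [TopologicalSpace.SeparableSpace S] [MeasurableSpace S] [BorelSpace S]
    (μ ν : Measure S) [IsProbabilityMeasure μ] [IsProbabilityMeasure ν] {ε : ℝ} (hε : 0 < ε)
    (h : ∀ E : Set S, MeasurableSet E → E.Nonempty →
      μ E ≤ ν {y | Metric.infDist y E < ε} + ENNReal.ofReal ε) :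
    ∃ π : Measure (S × S), π.map Prod.fst = μ ∧ π.map Prod.snd = ν ∧
      π {p | 5 * ε ≤ dist p.1 p.2} ≤ ENNReal.ofReal (5 * ε) := by
  classical
  obtain ⟨m, A, hA, hdisj, hdiam, hrest⟩ := exists_finite_partition (μ + ν) hε
  rw [Measure.add_apply] at hrest
  have hμA : ∀ (τ : Measure S) [IsProbabilityMeasure τ] (B : Finset (Fin m)),
      ∑ i ∈ B, τ.real (A i) = τ.real (⋃ i ∈ B, A i) := fun τ _ B =>
    (measureReal_biUnion_finset (fun i _ j _ hij => hdisj hij) fun i _ => hA i).symm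
  have hrestμ : μ.real (⋃ i, A i)ᶜ ≤ ε :=
    ENNReal.toReal_le_of_le_ofReal hε.le (le_self_add.trans hrest)
  have hrestν : ν.real (⋃ i, A i)ᶜ ≤ ε :=
    ENNReal.toReal_le_of_le_ofReal hε.le (le_add_self.trans hrest)
  -- The defect `2 * ε` is `ε` from the thickening bound plus `ε` for the `ν`-mass outside the
  -- cells.
  obtain ⟨w, hw0, hwR, hrow, hcol, hw⟩ := exists_real_transport
    (fun i j => ∃ x ∈ A i, ∃ y ∈ A j, dist x y < ε) (fun i => μ.real (A i))
    (fun i => ν.real (A i)) (fun _ => measureReal_nonneg) (fun _ => measureReal_nonneg)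
    (2 * ε) ε (by positivity) hε (by
      intro I J hIJ
      rw [hμA, hμA]
      rcases (⋃ i ∈ I, A i).eq_empty_or_nonempty with h0 | hne
      · rw [h0, measureReal_empty]
        positivity
      have h1 := h _ (I.measurableSet_biUnion fun i _ => hA i) hne
      have h2 : {y | Metric.infDist y (⋃ i ∈ I, A i) < ε} ⊆ (⋃ j ∈ J, A j) ∪ (⋃ i, A i)ᶜ := by
        intro y hy
        by_cases hyA : y ∈ ⋃ i, A i
        · obtain ⟨j, hj⟩ := Set.mem_iUnion.1 hyA
          obtain ⟨x, hx, hxy⟩ := (Metric.infDist_lt_iff hne).1 hy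
          obtain ⟨i, hi, hxi⟩ := Set.mem_iUnion₂.1 hx
          exact Or.inl (Set.mem_iUnion₂.2
            ⟨j, hIJ i hi j ⟨x, hxi, y, hj, by rwa [dist_comm]⟩, hj⟩)
        · exact Or.inr hyA
      have h3 : μ.real (⋃ i ∈ I, A i) ≤ ν.real {y | Metric.infDist y (⋃ i ∈ I, A i) < ε} + ε := by
        have := ENNReal.toReal_mono (by finiteness) h1
        rwa [ENNReal.toReal_add (by finiteness) (by finiteness), ENNReal.toReal_ofReal hε.le]
          at this
      have h4 := (measureReal_mono (μ := ν) h2).trans (measureReal_union_le _ _)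
      linarith)
  obtain ⟨ρ, h₁, h₂, hρ, hρ0⟩ := exists_subcoupling_of_plan μ ν A hA hdisj w hw0 hrow hcol
  have : IsFiniteMeasure ρ := ⟨by rw [hρ]; exact ENNReal.ofReal_lt_top⟩
  obtain ⟨π, hρπ, hπ₁, hπ₂⟩ := exists_coupling_ge μ ν ρ h₁ h₂
  refine ⟨π, hπ₁, hπ₂, ?_⟩
  have hπ : IsProbabilityMeasure π := ⟨by
    rw [← measure_univ (μ := μ), ← hπ₁, Measure.map_apply measurable_fst .univ, Set.preimage_univ]⟩
  -- Two cell diameters and one gap: `2 * ε + ε + 2 * ε`.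
  have hfar : ρ {p | 5 * ε ≤ dist p.1 p.2} = 0 := by
    refine hρ0 _ fun i j hij p hp => ?_
    obtain ⟨x, hx, y, hy, hxy⟩ := hwR i j hij
    have h1 := hdiam i _ hp.1 _ hx
    have h2 := hdiam j _ hy _ hp.2
    simp only [Set.mem_compl_iff, Set.mem_ofPred_eq, not_le]
    linarith [dist_triangle4 p.1 x y p.2]
  set F : Set (S × S) := {p | 5 * ε ≤ dist p.1 p.2}
  have hF : MeasurableSet F := by
    have : SecondCountableTopology S := UniformSpace.secondCountable_of_separable S
    exact measurableSet_le measurable_const (measurable_fst.dist measurable_snd)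
  have hnear : ENNReal.ofReal (∑ i, ∑ j, w i j) ≤ π Fᶜ := by
    have h1 : ρ Set.univ ≤ ρ F + ρ Fᶜ := by
      rw [← Set.union_compl_self F]
      exact measure_union_le _ _
    rw [hfar, zero_add, hρ] at h1
    exact h1.trans (hρπ _)
  -- Untransported mass is at most `4 * ε`: `ε` outside the cells, `2 * ε` defect, `ε` rounding.
  have hmass : 1 - ε ≤ ∑ i, μ.real (A i) := by
    rw [hμA μ Finset.univ]
    have := probReal_compl_eq_one_sub (μ := μ) (MeasurableSet.iUnion hA)
    simp only [Finset.mem_univ, Set.iUnion_true]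
    linarith
  have hreal : ∑ i, ∑ j, w i j ≤ π.real Fᶜ :=
    (ENNReal.ofReal_le_iff_le_toReal (measure_ne_top _ _)).1 hnear
  rw [probReal_compl_eq_one_sub hF] at hreal
  rw [ENNReal.le_ofReal_iff_toReal_le (measure_ne_top _ _) (by positivity)]
  change π.real F ≤ _
  linarith

/-! ### Pseudo-Lipschitz functions and the direct implication -/

theorem mem_PL_of_lipschitzWith_one {S : Type*} [NormedAddCommGroup S] {f : S → ℝ}
    (hf : LipschitzWith 1 f) (r : ℝ) : f ∈ PL S r := by
  intro x y
  have h := hf.dist_le_mul x y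
  rw [Real.dist_eq, NNReal.coe_one, one_mul, dist_eq_norm] at h
  have hx := Real.rpow_nonneg (norm_nonneg x) (r - 1)
  have hy := Real.rpow_nonneg (norm_nonneg y) (r - 1)
  exact h.trans (le_mul_of_one_le_right (norm_nonneg _) (by linarith))

theorem abs_sub_le_of_mem_PL {S : Type*} [NormedAddCommGroup S] {f : S → ℝ} {r : ℝ}
    (hr : 1 ≤ r) (hf : f ∈ PL S r) {x y : S} {T : ℝ} (hx : ‖x‖ ≤ T) (hy : ‖y‖ ≤ T) :
    |f x - f y| ≤ ‖x - y‖ * (1 + 2 * T ^ (r - 1)) := by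
  refine (hf x y).trans (mul_le_mul_of_nonneg_left ?_ (norm_nonneg _))
  have h1 := Real.rpow_le_rpow (norm_nonneg x) hx (sub_nonneg.2 hr)
  have h2 := Real.rpow_le_rpow (norm_nonneg y) hy (sub_nonneg.2 hr)
  linarith

theorem TightNorms.exists_eventually_lt {S Ω : ℕ → Type*} [∀ n, NormedAddCommGroup (S n)]
    [∀ n, MeasurableSpace (Ω n)] {P : ∀ n, Measure (Ω n)} {X : ∀ n, Ω n → S n}
    (h : TightNorms P X) {η : ENNReal} (hη : 0 < η) :
    ∃ t : ℝ, 0 ≤ t ∧ ∀ᶠ n in atTop, P n {ω | t ≤ ‖X n ω‖} < η := by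
  obtain ⟨t, ht, ht0⟩ := ((h.eventually_lt_const hη).and (eventually_ge_atTop 0)).exists
  exact ⟨t, ht0, eventually_lt_of_limsup_lt ht⟩

/-- When the points are within distance one, a norm below `t` for either puts both below `t + 1`.
Hence only the event that both norms are large must be rare, and tightness of one marginal suffices.
-/
theorem tendstoZeroInProb_of_mem_PL {S : ℕ → Type*} [∀ n, NormedAddCommGroup (S n)]
    [∀ n, MeasurableSpace (S n)] {π : ∀ n, Measure (S n × S n)}
    (hπ : TendstoZeroInProb π (fun _ p => ‖p.1 - p.2‖))
    (htight : ∀ η : ENNReal, 0 < η → ∃ t : ℝ, 0 ≤ t ∧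
      ∀ᶠ n in atTop, π n {p | t ≤ ‖p.1‖ ∧ t ≤ ‖p.2‖} < η)
    {r : ℝ} (hr : 1 ≤ r) {f : ∀ n, S n → ℝ} (hf : ∀ n, f n ∈ PL (S n) r) :
    TendstoZeroInProb π (fun n p => |f n p.1 - f n p.2|) := by
  intro ε hε
  rw [ENNReal.tendsto_nhds_zero]
  intro η hη
  obtain ⟨t, ht0, ht⟩ := htight (η / 2) (ENNReal.half_pos hη.ne')
  set K := 1 + 2 * (t + 1) ^ (r - 1)
  have hK : 0 < K := by positivity
  set δ := min 1 (ε / K)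
  have hδ : 0 < δ := by positivity
  filter_upwards [ht, (ENNReal.tendsto_nhds_zero.1 (hπ δ hδ)) _ (ENNReal.half_pos hη.ne')]
    with n h1 h2
  rw [← ENNReal.add_halves η]
  refine (measure_mono fun p hp => ?_).trans ((measure_union_le _ _).trans (add_le_add h1.le h2))
  by_contra hcon
  simp only [Set.mem_union, Set.mem_ofPred_eq, not_or, abs_norm, not_le, not_and_or,
    abs_abs] at hcon hp
  obtain ⟨hmin, hd⟩ := hcon
  have hd1 : ‖p.1 - p.2‖ < 1 := hd.trans_le (min_le_left _ _)
  have hd2 : ‖p.1 - p.2‖ < ε / K := hd.trans_le (min_le_right _ _)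
  have h3 := norm_sub_norm_le p.1 p.2
  have h4 := norm_sub_norm_le p.2 p.1
  rw [norm_sub_rev] at h4
  have hx : ‖p.1‖ ≤ t + 1 := by rcases hmin with h | h <;> linarith
  have hy : ‖p.2‖ ≤ t + 1 := by rcases hmin with h | h <;> linarith
  have h5 := abs_sub_le_of_mem_PL hr (hf n) hx hy
  rw [lt_div_iff₀ hK] at hd2
  linarith

theorem CoupledNormConv.coupledPLConv {S Ω Ω' : ℕ → Type*}
    [∀ n, NormedAddCommGroup (S n)] [∀ n, MeasurableSpace (S n)] [∀ n, BorelSpace (S n)]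
    [∀ n, MeasurableSpace (Ω n)] [∀ n, MeasurableSpace (Ω' n)]
    {P : ∀ n, Measure (Ω n)} {P' : ∀ n, Measure (Ω' n)}
    {X : ∀ n, Ω n → S n} (hX : ∀ n, Measurable (X n))
    {Y : ∀ n, Ω' n → S n} (hY : ∀ n, Measurable (Y n))
    (h : CoupledNormConv P X P' Y) (ht : TightNorms P X ∨ TightNorms P' Y) :
    CoupledPLConv P X P' Y := by
  obtain ⟨π, hc, hπ⟩ := h
  refine ⟨π, hc, fun r hr f hf => tendstoZeroInProb_of_mem_PL hπ (fun η hη => ?_) hr hf⟩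
  have hm : ∀ n (t : ℝ), MeasurableSet {x : S n | t ≤ ‖x‖} := fun n t =>
    (isClosed_le continuous_const continuous_norm).measurableSet
  rcases ht with ht | ht
  · obtain ⟨t, ht0, ht⟩ := ht.exists_eventually_lt hη
    refine ⟨t, ht0, ht.mono fun n hn => lt_of_le_of_lt ?_ hn⟩
    calc _ ≤ π n (Prod.fst ⁻¹' {x | t ≤ ‖x‖}) := measure_mono fun p hp => hp.1
      _ = _ := by
        rw [← Measure.map_apply measurable_fst (hm n t), (hc n).map_fst,
          Measure.map_apply (hX n) (hm n t)]
        rfl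
  · obtain ⟨t, ht0, ht⟩ := ht.exists_eventually_lt hη
    refine ⟨t, ht0, ht.mono fun n hn => lt_of_le_of_lt ?_ hn⟩
    calc _ ≤ π n (Prod.snd ⁻¹' {x | t ≤ ‖x‖}) := measure_mono fun p hp => hp.2
      _ = _ := by
        rw [← Measure.map_apply measurable_snd (hm n t), (hc n).map_snd,
          Measure.map_apply (hY n) (hm n t)]
        rfl

/-! ### The converse implication -/

/-- Under pseudo-Lipschitz convergence, the laws dominate each other up to thickening, uniformly
over all sets. -/
theorem eventually_measure_le_thickening {S : ℕ → Type*} [∀ n, NormedAddCommGroup (S n)]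
    [∀ n, MeasurableSpace (S n)] [∀ n, BorelSpace (S n)] {π : ∀ n, Measure (S n × S n)}
    {r : ℝ} (hπ : ∀ f : ∀ n, S n → ℝ, (∀ n, f n ∈ PL (S n) r) →
      TendstoZeroInProb π (fun n p => |f n p.1 - f n p.2|)) {ε : ℝ} (hε : 0 < ε) :
    ∀ᶠ n in atTop, ∀ E : Set (S n), MeasurableSet E → E.Nonempty →
      (π n).map Prod.fst E ≤
        (π n).map Prod.snd {y | Metric.infDist y E < ε} + ENNReal.ofReal ε := by
  -- Uniformity over sets: for each `n` pick a violating set if there is one, and test against the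
  -- single sequence of distances to these sets.
  have hex : ∀ n, ∃ E : Set (S n), (MeasurableSet E ∧ E.Nonempty ∧
      (π n).map Prod.snd {y | Metric.infDist y E < ε} + ENNReal.ofReal ε <
        (π n).map Prod.fst E) ∨
      ∀ E : Set (S n), MeasurableSet E → E.Nonempty → (π n).map Prod.fst E ≤
        (π n).map Prod.snd {y | Metric.infDist y E < ε} + ENNReal.ofReal ε := by
    intro n
    by_contra! hcon
    obtain ⟨-, E, h1, h2, h3⟩ := hcon ∅
    exact ((hcon E).1 h1 h2).not_gt h3
  choose E hE using hex
  have hlim := hπ (fun n x => Metric.infDist x (E n))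
    (fun n => mem_PL_of_lipschitzWith_one (Metric.lipschitz_infDist_pt _) r) ε hε
  filter_upwards [ENNReal.tendsto_nhds_zero.1 hlim _ (ENNReal.ofReal_pos.2 hε)] with n hn
  rcases hE n with ⟨hm, -, hbad⟩ | hgood
  · exfalso
    refine hbad.not_ge ?_
    rw [Measure.map_apply measurable_fst hm, Measure.map_apply measurable_snd
      (isOpen_lt (Metric.continuous_infDist_pt _) continuous_const).measurableSet]
    refine le_trans ?_ (add_le_add le_rfl hn)
    refine (measure_mono fun p hp => ?_).trans (measure_union_le _ _)
    rw [Set.mem_union, or_iff_not_imp_right]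
    intro hp'
    have h0 : Metric.infDist p.1 (E n) = 0 := Metric.infDist_zero_of_mem hp
    simpa [h0, abs_of_nonneg Metric.infDist_nonneg] using hp'
  · exact hgood

theorem CoupledPLConv.coupledNormConv {S Ω Ω' : ℕ → Type*}
    [∀ n, NormedAddCommGroup (S n)] [∀ n, TopologicalSpace.SeparableSpace (S n)]
    [∀ n, MeasurableSpace (S n)] [∀ n, BorelSpace (S n)]
    [∀ n, MeasurableSpace (Ω n)] [∀ n, MeasurableSpace (Ω' n)]
    {P : ∀ n, Measure (Ω n)} {P' : ∀ n, Measure (Ω' n)}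
    {X : ∀ n, Ω n → S n} {Y : ∀ n, Ω' n → S n}
    (h : CoupledPLConv P X P' Y) : CoupledNormConv P X P' Y := by
  classical
  obtain ⟨π₀, hc, hπ₀⟩ := h
  have hprob : ∀ n, IsProbabilityMeasure (π₀ n) := fun n => (hc n).isProbabilityMeasure
  let Good : ℕ → ℕ → Prop := fun n k => ∃ π : Measure (S n × S n),
    π.map Prod.fst = (π₀ n).map Prod.fst ∧ π.map Prod.snd = (π₀ n).map Prod.snd ∧
      π {p | 1 / ((k : ℝ) + 1) ≤ dist p.1 p.2} ≤ ENNReal.ofReal (1 / ((k : ℝ) + 1))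
  have hgood₀ : ∀ n, Good n 0 := fun n =>
    ⟨π₀ n, rfl, rfl, prob_le_one.trans (by simp)⟩
  have hgood : ∀ k, ∀ᶠ n in atTop, Good n k := by
    intro k
    -- Cancels the factor 5 of `exists_coupling_of_thickening`.
    have hε : (0 : ℝ) < 1 / ((k : ℝ) + 1) / 5 := by positivity
    filter_upwards [eventually_measure_le_thickening (hπ₀ 1 le_rfl) hε] with n hn
    have := Measure.isProbabilityMeasure_map (μ := π₀ n) measurable_fst.aemeasurable
    have := Measure.isProbabilityMeasure_map (μ := π₀ n) measurable_snd.aemeasurable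
    obtain ⟨π, h1, h2, h3⟩ := exists_coupling_of_thickening _ _ hε hn
    rw [mul_div_cancel₀ _ (by norm_num)] at h3
    exact ⟨π, h1, h2, h3⟩
  -- Diagonal choice: the best precision `k ≤ n` available at `n`, unbounded because every `k` is
  -- eventually good; `k = 0` is always good, its bound being one.
  have hmax : ∀ n, Good n (Nat.findGreatest (Good n) n) := fun n =>
    Nat.findGreatest_spec (Nat.zero_le n) (hgood₀ n)
  choose π h1 h2 h3 using hmax
  refine ⟨π, fun n => ⟨⟨?_⟩, (h1 n).trans (hc n).map_fst, (h2 n).trans (hc n).map_snd⟩, ?_⟩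
  · have := congrArg (fun τ => τ Set.univ) (h1 n)
    simpa [Measure.map_apply measurable_fst] using this
  · intro ε hε
    rw [ENNReal.tendsto_nhds_zero]
    intro η hη
    obtain ⟨η', hη'0, hη'⟩ := ENNReal.lt_iff_exists_real_btwn.1 hη
    rw [ENNReal.ofReal_pos] at hη'
    obtain ⟨k, hk⟩ := exists_nat_one_div_lt (lt_min hε hη'.1)
    filter_upwards [hgood k, eventually_ge_atTop k] with n hn hkn
    have hle : 1 / ((Nat.findGreatest (Good n) n : ℝ) + 1) ≤ 1 / ((k : ℝ) + 1) := by
      have : k ≤ Nat.findGreatest (Good n) n := Nat.le_findGreatest hkn hn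
      gcongr
    have hlt := hle.trans_lt hk
    refine (measure_mono fun p hp => ?_).trans ((h3 n).trans
      ((ENNReal.ofReal_le_ofReal (hlt.le.trans (min_le_right _ _))).trans hη'.2.le))
    simp only [Set.mem_ofPred_eq, abs_norm, dist_eq_norm] at hp ⊢
    exact (hlt.le.trans (min_le_left _ _)).trans hp

theorem theorem6 {S Ω Ω' : ℕ → Type*}
    [∀ n, NormedAddCommGroup (S n)] [∀ n, NormedSpace ℝ (S n)] [∀ n, CompleteSpace (S n)]
    [∀ n, TopologicalSpace.SeparableSpace (S n)]
    [∀ n, MeasurableSpace (S n)] [∀ n, BorelSpace (S n)]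
    [∀ n, MeasurableSpace (Ω n)] [∀ n, MeasurableSpace (Ω' n)]
    (P : ∀ n, Measure (Ω n)) [∀ n, IsProbabilityMeasure (P n)]
    (P' : ∀ n, Measure (Ω' n)) [∀ n, IsProbabilityMeasure (P' n)]
    (X : ∀ n, Ω n → S n) (hX : ∀ n, Measurable (X n))
    (Y : ∀ n, Ω' n → S n) (hY : ∀ n, Measurable (Y n)) :
    (CoupledNormConv P X P' Y ∧ (TightNorms P X ∨ TightNorms P' Y) → CoupledPLConv P X P' Y) ∧
    (CoupledPLConv P X P' Y → CoupledNormConv P X P' Y) :=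
  ⟨fun h => h.1.coupledPLConv hX hY h.2, fun h => h.coupledNormConv⟩
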